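/- Let $K$ be an algebraically closed field and $n\ge 1$. Let $T_n$ be the affine space of upper triangular $n\times n$ matrices over $K$, $U_n\subset T_n$ the strictly upper triangular ones, $CT_n=\{(X,Y)\in T_n\times T_n : [X,Y]=0\}$ and $NT_n=CT_n\cap(U_n\times U_n)$. Call an $n\times n$ matrix regular if its minimal polynomial has degree $n$. Let $CT_n^0$ (resp. $NT_n^0$) be the Zariski closure of the set of pairs $(X,Y)\in CT_n$ (resp. $(X,Y)\in NT_n$) with both $X$ and $Y$ regular. Then: (i) $CT_n^0$ is irreducible of dimension $\frac{n(n+3)}{2}$, and this number is the minimum of the dimensions of the irreducible components of $CT_n$. (ii) $NT_n^0$ is irreducible of dimension $\frac{n(n+1)}{2}-1$, and this number is the minimum of the dimensions of the irreducible components of $NT_n$. (iii) $CT_n$ is a complete intersection if and only if all its irreducible components have the same dimension. This holds for both of the following meanings of "complete intersection": (a) the ideal of $K[T_n\times T_n]$ generated by the entries of $[X,Y]$ can be generated by as many elements as its height; (b) $CT_n$ is the set of common zeros in $T_n\times T_n$ of $\operatorname{codim}(CT_n)$ many polynomials, where $\operatorname{codim}(CT_n)=n(n+1)-\dim CT_n$.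 -/

import Mathlib

namespace CommTri

noncomputable section

/-! ## Affine space over `K`: Zariski topology, components, dimension -/

/-- The affine space `K ^ σ`, as a set of `K`-points. -/
def AffinePoint (σ K : Type*) : Type _ := σ → K

/-- The Zariski topology on `K ^ σ`: the closed sets are the zero loci of ideals of `K[σ]`. -/
instance zariski (σ K : Type*) [Field K] : TopologicalSpace (AffinePoint σ K) :=
  TopologicalSpace.ofClosed
    {S : Set (σ → K) | ∃ I : Ideal (MvPolynomial σ K), MvPolynomial.zeroLocus K I = S}
    ⟨⊤, MvPolynomial.zeroLocus_top⟩
    (by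
      intro A hA
      refine ⟨sSup {I | MvPolynomial.zeroLocus K I ∈ A}, ?_⟩
      refine eq_of_forall_le_iff fun V => ?_
      rw [MvPolynomial.le_zeroLocus_iff_le_vanishingIdeal, sSup_le_iff]
      constructor
      · intro h x hx S hS
        obtain ⟨I, rfl⟩ := hA hS
        exact MvPolynomial.le_zeroLocus_iff_le_vanishingIdeal.2 (h I hS) hx
      · intro h I hI
        exact MvPolynomial.le_zeroLocus_iff_le_vanishingIdeal.1 fun x hx => h hx _ hI)
    (by
      rintro _ ⟨I, rfl⟩ _ ⟨J, rfl⟩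
      refine ⟨I * J, ?_⟩
      ext x
      constructor
      · intro h
        by_contra hx
        obtain ⟨hx1, hx2⟩ := not_or.1 hx
        obtain ⟨p, hp, hp0⟩ : ∃ p ∈ I, MvPolynomial.aeval x p ≠ 0 := by
          by_contra! hc
          exact hx1 hc
        obtain ⟨q, hq, hq0⟩ : ∃ q ∈ J, MvPolynomial.aeval x q ≠ 0 := by
          by_contra! hc
          exact hx2 hc
        have := h (p * q) (Ideal.mul_mem_mul hp hq)
        rw [map_mul] at this
        exact (mul_ne_zero hp0 hq0) this
      · rintro (h | h)
        · exact MvPolynomial.zeroLocus_anti_mono Ideal.mul_le_left h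
        · exact MvPolynomial.zeroLocus_anti_mono Ideal.mul_le_right h)

theorem isClosed_iff {σ K : Type*} [Field K] (S : Set (AffinePoint σ K)) :
    IsClosed S ↔ ∃ I : Ideal (MvPolynomial σ K), MvPolynomial.zeroLocus K I = S := by
  rw [← isOpen_compl_iff]
  change Sᶜᶜ ∈ _ ↔ _
  rw [compl_compl]
  rfl

/-- The irreducible components of a subset `V`: the maximal irreducible subsets of `V`. -/
def components {σ K : Type*} [Field K] (V : Set (AffinePoint σ K)) :
    Set (Set (AffinePoint σ K)) :=
  {Z | Maximal (fun W => IsIrreducible W ∧ W ⊆ V) Z}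

/-- The dimension of an affine variety `V ⊆ K ^ σ`: the Krull dimension of its coordinate
ring `K[σ] / I(V)`. -/
def zdim {σ K : Type*} [Field K] (V : Set (AffinePoint σ K)) : WithBot ℕ∞ :=
  ringKrullDim (MvPolynomial σ K ⧸ MvPolynomial.vanishingIdeal K (K := K) (σ := σ) V)

/-- An ideal is a complete intersection if it can be generated by as many elements as its height. -/
def IsCompleteIntersection {R : Type*} [CommRing R] (I : Ideal R) : Prop :=
  ∃ s : Finset R, Ideal.span (s : Set R) = I ∧ (s.card : ℕ∞) = I.height

/-- A subset of `K ^ σ` is a set-theoretic complete intersection if it is the set of common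
zeros of as many polynomials as its codimension. -/
def IsSetTheoreticCompleteIntersection {σ K : Type*} [Fintype σ] [Field K]
    (V : Set (AffinePoint σ K)) : Prop :=
  ∃ s : Finset (MvPolynomial σ K),
    V = MvPolynomial.zeroLocus K (Ideal.span (s : Set (MvPolynomial σ K))) ∧
      zdim V + (s.card : WithBot ℕ∞) = (Fintype.card σ : WithBot ℕ∞)

/-! ## Pairs of commuting upper triangular matrices -/

/-- The positions `(i, j)` with `i ≤ j`. -/
abbrev TriIdx (n : ℕ) : Type := {p : Fin n × Fin n // p.1 ≤ p.2}

/-- The upper triangular matrix with prescribed entries on and above the diagonal. -/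
def upper {n : ℕ} {R : Type*} [Zero R] (c : TriIdx n → R) : Matrix (Fin n) (Fin n) R :=
  Matrix.of fun i j => if h : i ≤ j then c ⟨(i, j), h⟩ else 0

/-- `upper` identifies families of entries with upper triangular matrices. -/
theorem existsUnique_upper_eq_iff {n : ℕ} {R : Type*} [Zero R] (M : Matrix (Fin n) (Fin n) R) :
    (∃! c : TriIdx n → R, upper c = M) ↔ M.BlockTriangular id := by
  constructor
  · rintro ⟨c, rfl, -⟩ i j hij
    exact dif_neg (not_le.2 hij)
  · intro hM
    refine ⟨fun p => M p.1.1 p.1.2, ?_, ?_⟩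
    · ext i j
      by_cases h : i ≤ j
      · exact dif_pos h
      · exact (dif_neg h).trans (hM (not_le.1 h)).symm
    · rintro c rfl
      funext p
      obtain ⟨⟨i, j⟩, h⟩ := p
      simp only [upper, Matrix.of_apply, dif_pos h]

/-- The coordinates of `T_n × T_n`. -/
abbrev PairIdx (n : ℕ) : Type := TriIdx n ⊕ TriIdx n

/-- The affine space `T_n × T_n` of pairs of upper triangular `n × n` matrices over `K`. -/
abbrev TriPair (n : ℕ) (K : Type*) : Type _ := AffinePoint (PairIdx n) K

/-- The first matrix of a pair. -/
def TriPair.fst {n : ℕ} {K : Type*} [Zero K] (p : TriPair n K) : Matrix (Fin n) (Fin n) K :=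
  upper fun a => p (Sum.inl a)

/-- The second matrix of a pair. -/
def TriPair.snd {n : ℕ} {K : Type*} [Zero K] (p : TriPair n K) : Matrix (Fin n) (Fin n) K :=
  upper fun a => p (Sum.inr a)

/-- `M` is strictly upper triangular: its entries on and below the diagonal vanish. -/
def IsStrictlyUpper {n : ℕ} {K : Type*} [Zero K] (M : Matrix (Fin n) (Fin n) K) : Prop :=
  ∀ i j, j ≤ i → M i j = 0

/-- `M` is regular: its minimum polynomial has degree `n`. -/
def IsRegularMatrix {n : ℕ} {K : Type*} [Field K] (M : Matrix (Fin n) (Fin n) K) : Prop :=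
  (minpoly K M).natDegree = n

/-- `CT_n`: the commuting pairs of upper triangular matrices. -/
def CT (n : ℕ) (K : Type*) [Field K] : Set (TriPair n K) :=
  {p | p.fst * p.snd - p.snd * p.fst = 0}

/-- `NT_n`: the commuting pairs of strictly upper triangular matrices. -/
def NT (n : ℕ) (K : Type*) [Field K] : Set (TriPair n K) :=
  CT n K ∩ {p | IsStrictlyUpper p.fst ∧ IsStrictlyUpper p.snd}

/-- `CT_n^0`: the Zariski closure of the set of pairs of regular matrices in `CT_n`. -/
def CT0 (n : ℕ) (K : Type*) [Field K] : Set (TriPair n K) :=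
  closure {p | p ∈ CT n K ∧ IsRegularMatrix p.fst ∧ IsRegularMatrix p.snd}

/-- `NT_n^0`: the Zariski closure of the set of pairs of regular matrices in `NT_n`. -/
def NT0 (n : ℕ) (K : Type*) [Field K] : Set (TriPair n K) :=
  closure {p | p ∈ NT n K ∧ IsRegularMatrix p.fst ∧ IsRegularMatrix p.snd}

/-- The commutator `[X, Y]` of two generic upper triangular matrices. -/
def genericCommutator (n : ℕ) (K : Type*) [Field K] :
    Matrix (Fin n) (Fin n) (MvPolynomial (PairIdx n) K) :=
  let X := upper fun a : TriIdx n => (MvPolynomial.X (Sum.inl a) : MvPolynomial (PairIdx n) K)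
  let Y := upper fun a : TriIdx n => (MvPolynomial.X (Sum.inr a) : MvPolynomial (PairIdx n) K)
  X * Y - Y * X

/-- The ideal of the equations of `CT_n`, generated by the entries of `[X, Y]`. -/
def commIdeal (n : ℕ) (K : Type*) [Field K] : Ideal (MvPolynomial (PairIdx n) K) :=
  Ideal.span {f | ∃ i j, f = genericCommutator n K i j}

/-- `CT_n` is the zero locus of the entries of `[X, Y]`. -/
theorem zeroLocus_commIdeal (n : ℕ) (K : Type*) [Field K] :
    MvPolynomial.zeroLocus K (commIdeal n K) = CT n K := by
  have key : ∀ (p : PairIdx n → K) (i j : Fin n),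
      MvPolynomial.aeval p (genericCommutator n K i j) =
        (TriPair.fst (n := n) p * TriPair.snd (n := n) p -
          TriPair.snd (n := n) p * TriPair.fst (n := n) p) i j := by
    intro p i j
    simp only [genericCommutator, Matrix.sub_apply, Matrix.mul_apply, map_sub, map_sum, map_mul,
      upper, TriPair.fst, TriPair.snd, Matrix.of_apply, apply_dite (MvPolynomial.aeval p),
      MvPolynomial.aeval_X, map_zero]
  rw [commIdeal, MvPolynomial.zeroLocus_span]
  ext p
  constructor
  · intro h
    refine Matrix.ext fun i j => ?_
    rw [← key]
    exact h _ ⟨i, j, rfl⟩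
  · rintro h _ ⟨i, j, rfl⟩
    rw [key]
    exact congrFun (congrFun h i) j

end

end CommTri

/-! A matrix commuting with a regular matrix is a polynomial in it (`exists_eq_sum_of_commute`). So
a commuting pair of regular upper triangular matrices is determined by `X` together with `n`
coefficients; in the strictly upper triangular case the constant coefficient drops out and `n - 1`
remain. Regularity is an open condition (`isOpen_isRegularMatrix`), hence the regular pairs form an
open part of the variety that is parametrized by an open part of an affine space. Their closure is
therefore an irreducible component, of dimension at most the number of parameters.

Conversely, Krull's height theorem bounds the dimension of every component from below by the number
of variables minus the number of equations. Redundant equations must be discarded first: only the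
commutator entries above the diagonal matter for `CT n K`, and only those above the first
superdiagonal, together with the `2 * n` diagonal coordinates, for `NT n K`. After this the lower
bound equals the number of parameters, so the regular component attains the minimum
(`isLeast_zdim_of_parametrization`).

Part (iii) is then formal. The least dimension is what the chosen equations predict, so if all
components share it, these equations already form a complete intersection. In the other direction
Krull's theorem forces equidimensionality. Heights and dimensions are exchanged by
`height_add_ringKrullDim_eq`. -/

namespace CommTri

/-! ### Dimension theory of affine algebras and polynomial rings -/

/-- A chain of primes in the base of an integral extension of a normal domain lifts, and chains
upstairs contract to chains, so both rings have the same dimension. -/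
theorem ringKrullDim_eq_of_isIntegral (R S : Type*) [CommRing R] [CommRing S] [IsDomain S]
    [Algebra R S] [FaithfulSMul R S] [Algebra.IsIntegral R S] [IsIntegrallyClosed R] :
    ringKrullDim S = ringKrullDim R := by
  apply le_antisymm
  · refine Order.krullDim_le_of_strictMono (PrimeSpectrum.comap (algebraMap R S)) ?_
    intro p q h
    exact Ideal.IsIntegral.comap_lt_comap h
  · refine iSup_le fun l => ?_
    obtain ⟨Q⟩ := Ideal.nonempty_primesOver (S := S) l.last.asIdeal
    have := Q.2.1
    have := Q.2.2
    obtain ⟨L, hL, -⟩ := Ideal.exists_ltSeries_of_hasGoingDown l Q.1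
    rw [← hL]
    exact Order.LTSeries.length_le_krullDim L

/-- By Noether normalization `A` is integral over a polynomial ring in `s` variables, and an
integral extension changes neither invariant; both equal `s`. -/
theorem ringKrullDim_eq_trdeg (k A : Type*) [Field k] [CommRing A] [IsDomain A] [Algebra k A]
    [Algebra.FiniteType k A] :
    ringKrullDim A = (Cardinal.toENat (Algebra.trdeg k A) : WithBot ℕ∞) := by
  obtain ⟨s, g, hg, hint⟩ := exists_integral_inj_algHom_of_fg k A
  algebraize [g.toRingHom]
  have hgmap : ⇑(algebraMap (MvPolynomial (Fin s) k) A) = g := rfl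
  have : FaithfulSMul (MvPolynomial (Fin s) k) A :=
    (faithfulSMul_iff_algebraMap_injective _ _).2 hg
  have : Algebra.IsIntegral (MvPolynomial (Fin s) k) A := ⟨hint⟩
  have : IsScalarTower k (MvPolynomial (Fin s) k) A :=
    IsScalarTower.of_algebraMap_eq fun x => (g.commutes x).symm
  rw [ringKrullDim_eq_of_isIntegral (MvPolynomial (Fin s) k) A,
    MvPolynomial.ringKrullDim_of_isNoetherianRing, ringKrullDim_eq_zero_of_field, zero_add]
  have h := lift_trdeg_add_eq k (MvPolynomial (Fin s) k) A
  rw [trdeg_eq_zero (R := MvPolynomial (Fin s) k) (A := A),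
    MvPolynomial.trdeg_of_isDomain] at h
  have h2 := congrArg Cardinal.toENat h
  simp at h2
  rw [← h2]
  simp

/-- Going down holds for the flat extension `A → A[X]`, so the height upstairs is the height of `p`
plus a fibre term. -/
theorem height_map_C_ge {A : Type*} [CommRing A] [IsNoetherianRing A] (p : Ideal A) [p.IsPrime] :
    p.height ≤ (p.map (Polynomial.C : A →+* Polynomial A)).height := by
  have : (p.map (Polynomial.C : A →+* Polynomial A)).IsPrime := Ideal.isPrime_map_C_of_isPrime
  have : Nontrivial A := Submodule.nontrivial_iff A |>.1 ⟨p, ⊤, Ideal.IsPrime.ne_top ‹_›⟩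
  have : (p.map (Polynomial.C : A →+* Polynomial A)).LiesOver p :=
    ⟨(Ideal.comap_map_eq_self_of_faithfullyFlat p).symm⟩
  rw [Ideal.height_eq_height_add_of_liesOver_of_hasGoingDown p
    (p.map (Polynomial.C : A →+* Polynomial A))]
  exact le_self_add

/-- Let `p` be the contraction of `P`. If `P = p[X]`, the quotient is `(A ⧸ p)[X]` and the
transcendence degree gains one; otherwise `P` lies strictly above `p[X]` and the height gains one.
-/
theorem le_height_add_trdeg_polynomial {k A : Type*} [Field k] [CommRing A] [IsNoetherianRing A]
    [Algebra k A] (n : ℕ∞)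
    (h : ∀ p : Ideal A, p.IsPrime → n ≤ p.height + Cardinal.toENat (Algebra.trdeg k (A ⧸ p)))
    (P : Ideal (Polynomial A)) [P.IsPrime] :
    n + 1 ≤ P.height + Cardinal.toENat (Algebra.trdeg k (Polynomial A ⧸ P)) := by
  set p : Ideal A := P.comap Polynomial.C with hp
  have hpP : p.IsPrime := Ideal.IsPrime.comap _
  have hle : p.map Polynomial.C ≤ P := Ideal.map_comap_le
  have : (p.map (Polynomial.C : A →+* Polynomial A)).IsPrime := Ideal.isPrime_map_C_of_isPrime
  rcases hle.eq_or_lt with heq | hlt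
  · have h1 : Cardinal.toENat (Algebra.trdeg k (A ⧸ p)) + 1 ≤
        Cardinal.toENat (Algebra.trdeg k (Polynomial A ⧸ P)) := by
      let e : Polynomial (A ⧸ p) ≃ₐ[k] (Polynomial A ⧸ p.map Polynomial.C) :=
        AlgEquiv.ofRingEquiv (f := Ideal.polynomialQuotientEquivQuotientPolynomial p) (by
          intro x
          have := Ideal.polynomialQuotientEquivQuotientPolynomial_map_mk p
            (algebraMap k (Polynomial A) x)
          rw [Polynomial.algebraMap_apply, Polynomial.map_C] at this
          exact this)
      rw [← (e.trans (Ideal.quotientEquivAlgOfEq k heq)).trdeg_eq,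
        ← trdeg_add_eq k (A ⧸ p) (A := Polynomial (A ⧸ p)), map_add,
        Polynomial.trdeg_of_isDomain, map_one]
    calc n + 1 ≤ p.height + Cardinal.toENat (Algebra.trdeg k (A ⧸ p)) + 1 := by gcongr; exact h p hpP
      _ = p.height + (Cardinal.toENat (Algebra.trdeg k (A ⧸ p)) + 1) := add_assoc _ _ _
      _ ≤ _ := add_le_add ((height_map_C_ge p).trans (Ideal.height_mono hle)) h1
  · have h1 : p.height + 1 ≤ P.height :=
      (add_le_add_left (height_map_C_ge p) 1).trans
        (Order.add_one_le_of_lt (Ideal.height_strict_mono_of_isPrime hlt))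
    have h2 : Algebra.trdeg k (A ⧸ p) ≤ Algebra.trdeg k (Polynomial A ⧸ P) := by
      refine trdeg_le_of_injective
        (Ideal.quotientMapₐ P (Polynomial.CAlgHom (R := k) (A := A)) le_rfl) ?_
      exact Ideal.quotientMap_injective
    calc n + 1 ≤ p.height + Cardinal.toENat (Algebra.trdeg k (A ⧸ p)) + 1 := by gcongr; exact h p hpP
      _ = p.height + 1 + Cardinal.toENat (Algebra.trdeg k (A ⧸ p)) := by ring
      _ ≤ _ := by
        gcongr

theorem le_height_add_trdeg_of_algEquiv {k A B : Type*} [Field k] [CommRing A] [CommRing B]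
    [Algebra k A] [Algebra k B] (e : A ≃ₐ[k] B) {n : ℕ∞}
    (h : ∀ p : Ideal A, p.IsPrime → n ≤ p.height + Cardinal.toENat (Algebra.trdeg k (A ⧸ p)))
    (P : Ideal B) [P.IsPrime] :
    n ≤ P.height + Cardinal.toENat (Algebra.trdeg k (B ⧸ P)) := by
  refine (h (P.comap e) inferInstance).trans (add_le_add ?_ ?_)
  · exact (e.toRingEquiv.height_comap P).le
  · have := lift_trdeg_le_of_injective (Ideal.quotientMapₐ P (e : A →ₐ[k] B) le_rfl)
      Ideal.quotientMap_injective
    rw [← Cardinal.toENat_lift, ← Cardinal.toENat_lift (c := Algebra.trdeg k (B ⧸ P))]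
    exact Cardinal.toENat.monotone' this

theorem card_le_height_add_trdeg (k σ : Type*) [Field k] [Finite σ]
    (P : Ideal (MvPolynomial σ k)) [P.IsPrime] :
    (Nat.card σ : ℕ∞) ≤ P.height + Cardinal.toENat (Algebra.trdeg k (MvPolynomial σ k ⧸ P)) := by
  induction σ using Finite.induction_empty_option with
  | of_equiv e H =>
    rw [← Nat.card_congr e]
    exact le_height_add_trdeg_of_algEquiv (MvPolynomial.renameEquiv k e) (fun p _ => H p) P
  | h_empty => simp
  | h_option H =>
    rw [Finite.card_option, Nat.cast_succ]
    exact le_height_add_trdeg_of_algEquiv (MvPolynomial.optionEquivLeft k _).symm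
      (fun p _ => le_height_add_trdeg_polynomial _ (fun q _ => H q) p) P

theorem coheight_eq_ringKrullDim_quotient {R : Type*} [CommRing R] (p : PrimeSpectrum R) :
    Order.coheight p = ringKrullDim (R ⧸ p.asIdeal) := by
  rw [ringKrullDim_quotient, Order.coheight_eq_krullDim_Ici]
  rfl

theorem height_add_ringKrullDim_le {R : Type*} [CommRing R] (P : Ideal R) [hP : P.IsPrime] :
    P.height + ringKrullDim (R ⧸ P) ≤ ringKrullDim R := by
  have : Nonempty (PrimeSpectrum R) := ⟨⟨P, hP⟩⟩
  rw [← coheight_eq_ringKrullDim_quotient ⟨P, hP⟩, PrimeSpectrum.height_eq_orderHeight ⟨P, hP⟩,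
    ringKrullDim, Order.krullDim_eq_iSup_height_add_coheight_of_nonempty]
  exact_mod_cast le_iSup (fun a : PrimeSpectrum R => Order.height a + Order.coheight a) ⟨P, hP⟩

/-- Every prime over `I` contains a minimal one `P`, so its quotient is a quotient of `R ⧸ P`. -/
theorem ringKrullDim_quotient_le_of_minimalPrimes {R : Type*} [CommRing R] (I : Ideal R)
    {d : WithBot ℕ∞} (h : ∀ P ∈ I.minimalPrimes, ringKrullDim (R ⧸ P) ≤ d) :
    ringKrullDim (R ⧸ I) ≤ d := by
  rw [ringKrullDim, Order.krullDim_eq_iSup_coheight]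
  refine iSup_le fun q => ?_
  rw [coheight_eq_ringKrullDim_quotient]
  have hq : I ≤ q.asIdeal.comap (Ideal.Quotient.mk I) := by
    conv_lhs => rw [← Ideal.mk_ker (I := I)]
    exact Ideal.comap_mono bot_le
  obtain ⟨P, hP, hPq⟩ := Ideal.exists_minimalPrimes_le hq
  refine le_trans ?_ (h P hP)
  refine ringKrullDim_le_of_surjective
    (Ideal.Quotient.lift P ((Ideal.Quotient.mk q.asIdeal).comp (Ideal.Quotient.mk I))
      fun a ha => Ideal.Quotient.eq_zero_iff_mem.2 (hPq ha))
    (Ideal.Quotient.lift_surjective_of_surjective _ _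
      (Ideal.Quotient.mk_surjective.comp Ideal.Quotient.mk_surjective))

/-- The dimension formula for a prime ideal of a polynomial ring over a field. -/
theorem height_add_ringKrullDim_eq (k σ : Type*) [Field k] [Finite σ]
    (P : Ideal (MvPolynomial σ k)) [P.IsPrime] :
    P.height + ringKrullDim (MvPolynomial σ k ⧸ P) = Nat.card σ := by
  apply le_antisymm
  · simpa [MvPolynomial.ringKrullDim_of_isNoetherianRing] using height_add_ringKrullDim_le P
  · rw [ringKrullDim_eq_trdeg k]
    exact_mod_cast card_le_height_add_trdeg k σ P

end CommTri

/-! ### Closed sets, ideals and polynomial maps -/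

namespace CommTri

open MvPolynomial

section Zariski

variable {σ τ K : Type*} [Field K]

/-- Evaluation of polynomials at a point of affine space. -/
noncomputable def evalAt (x : AffinePoint σ K) : MvPolynomial σ K →ₐ[K] K :=
  aeval (x : σ → K)

/-- The set of common zeros of an ideal, as a subset of affine space. -/
def locus (I : Ideal (MvPolynomial σ K)) : Set (AffinePoint σ K) := zeroLocus K I

/-- The ideal of polynomials vanishing on a subset of affine space. -/
def idealOf (S : Set (AffinePoint σ K)) : Ideal (MvPolynomial σ K) :=
  vanishingIdeal K (K := K) (σ := σ) S

@[simp]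
theorem evalAt_X (x : AffinePoint σ K) (i : σ) : evalAt x (X i) = x i :=
  aeval_X (x : σ → K) i

theorem mem_locus {I : Ideal (MvPolynomial σ K)} {x : AffinePoint σ K} :
    x ∈ locus I ↔ ∀ f ∈ I, evalAt x f = 0 := Iff.rfl

theorem mem_idealOf {S : Set (AffinePoint σ K)} {f : MvPolynomial σ K} :
    f ∈ idealOf S ↔ ∀ x ∈ S, evalAt x f = 0 := Iff.rfl

theorem isClosed_iff_locus (S : Set (AffinePoint σ K)) : IsClosed S ↔ ∃ I, locus I = S :=
  isClosed_iff S

theorem isClosed_locus (I : Ideal (MvPolynomial σ K)) : IsClosed (locus I) :=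
  (isClosed_iff_locus _).2 ⟨I, rfl⟩

theorem subset_locus_iff {S : Set (AffinePoint σ K)} {I : Ideal (MvPolynomial σ K)} :
    S ⊆ locus I ↔ I ≤ idealOf S :=
  ⟨fun h _ hf _ hx => h hx _ hf, fun h _ hx _ hf => h hf _ hx⟩

theorem idealOf_anti {S T : Set (AffinePoint σ K)} (h : S ⊆ T) : idealOf T ≤ idealOf S :=
  fun _ hf _ hx => hf _ (h hx)

theorem locus_anti {I J : Ideal (MvPolynomial σ K)} (h : I ≤ J) : locus J ⊆ locus I :=
  fun _ hx _ hf => hx _ (h hf)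

theorem locus_span (s : Set (MvPolynomial σ K)) :
    locus (Ideal.span s) = {x : AffinePoint σ K | ∀ f ∈ s, evalAt x f = 0} :=
  zeroLocus_span s

theorem idealOf_locus [IsAlgClosed K] [Finite σ] (I : Ideal (MvPolynomial σ K)) :
    idealOf (locus I) = I.radical :=
  vanishingIdeal_zeroLocus_eq_radical I

theorem idealOf_locus_of_isPrime [IsAlgClosed K] [Finite σ] (P : Ideal (MvPolynomial σ K))
    [P.IsPrime] : idealOf (locus P) = P :=
  IsPrime.vanishingIdeal_zeroLocus P

theorem zdim_eq (S : Set (AffinePoint σ K)) :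
    zdim S = ringKrullDim (MvPolynomial σ K ⧸ idealOf S) := rfl

theorem closure_eq_locus (S : Set (AffinePoint σ K)) : closure S = locus (idealOf S) := by
  apply subset_antisymm
  · exact closure_minimal (subset_locus_iff.2 le_rfl) (isClosed_locus _)
  · obtain ⟨I, hI⟩ := (isClosed_iff_locus (closure S)).1 isClosed_closure
    rw [← hI]
    exact locus_anti (subset_locus_iff.1 (subset_closure.trans hI.ge))

theorem idealOf_closure (S : Set (AffinePoint σ K)) : idealOf (closure S) = idealOf S := by
  apply le_antisymm
  · exact idealOf_anti subset_closure
  · rw [← subset_locus_iff, closure_eq_locus]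

theorem isIrreducible_iff_isPrime (S : Set (AffinePoint σ K)) :
    IsIrreducible S ↔ (idealOf S).IsPrime := by
  constructor
  · rintro ⟨⟨x, hx⟩, h⟩
    refine ⟨fun ht => ?_, fun {f g} hfg => ?_⟩
    · have : (1 : MvPolynomial σ K) ∈ idealOf S := ht ▸ Submodule.mem_top
      simpa using this x hx
    · have := isPreirreducible_iff_isClosed_union_isClosed.1 h _ _
        (isClosed_locus (Ideal.span {f})) (isClosed_locus (Ideal.span {g})) fun y hy => by
          have := mem_idealOf.1 hfg y hy
          rw [map_mul, mul_eq_zero] at this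
          simpa [locus_span] using this
      simpa only [subset_locus_iff, Ideal.span_singleton_le_iff_mem] using this
  · intro h
    refine ⟨?_, isPreirreducible_iff_isClosed_union_isClosed.2 fun Z W hZ hW hS => ?_⟩
    · rw [Set.nonempty_iff_ne_empty]
      rintro rfl
      exact h.ne_top vanishingIdeal_empty
    · obtain ⟨I, rfl⟩ := (isClosed_iff_locus _).1 hZ
      obtain ⟨J, rfl⟩ := (isClosed_iff_locus _).1 hW
      have hIJ : I * J ≤ idealOf S := by
        rw [Ideal.mul_le]
        intro f hf g hg
        rw [mem_idealOf]
        intro x hx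
        rw [map_mul, mul_eq_zero]
        exact (hS hx).imp (fun h => h f hf) fun h => h g hg
      rw [subset_locus_iff, subset_locus_iff]
      exact h.mul_le.1 hIJ

/-- Closures of irreducible sets are irreducible, so maximality makes a component closed; the
Nullstellensatz then turns maximal irreducible sets into minimal primes. -/
theorem mem_components_iff [IsAlgClosed K] [Finite σ] (I : Ideal (MvPolynomial σ K))
    (Z : Set (AffinePoint σ K)) :
    Z ∈ components (locus I) ↔ ∃ P ∈ I.minimalPrimes, Z = locus P := by
  constructor
  · rintro ⟨⟨hZ, hZV⟩, hmax⟩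
    have hcl : closure Z = Z :=
      subset_antisymm (hmax ⟨hZ.closure, closure_minimal hZV (isClosed_locus I)⟩ subset_closure)
        subset_closure
    rw [closure_eq_locus] at hcl
    refine ⟨idealOf Z, ⟨⟨(isIrreducible_iff_isPrime Z).1 hZ, subset_locus_iff.1 hZV⟩, ?_⟩,
      hcl.symm⟩
    rintro Q ⟨hQ, hIQ⟩ hQZ
    have hQ' := idealOf_locus_of_isPrime Q
    have hirr : IsIrreducible (locus Q) := by
      rwa [isIrreducible_iff_isPrime, hQ']
    rw [← hQ']
    exact idealOf_anti (hmax ⟨hirr, locus_anti hIQ⟩ (subset_locus_iff.2 hQZ))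
  · rintro ⟨P, ⟨⟨hP, hIP⟩, hmin⟩, rfl⟩
    have hP' := idealOf_locus_of_isPrime P
    refine ⟨⟨by rwa [isIrreducible_iff_isPrime, hP'], locus_anti hIP⟩, ?_⟩
    rintro W ⟨hW, hWV⟩ hPW
    refine subset_locus_iff.2 (hmin ⟨(isIrreducible_iff_isPrime W).1 hW, subset_locus_iff.1 hWV⟩ ?_)
    rw [← hP']
    exact idealOf_anti hPW

theorem zdim_locus [IsAlgClosed K] [Finite σ] (P : Ideal (MvPolynomial σ K)) [P.IsPrime] :
    zdim (locus P) = ringKrullDim (MvPolynomial σ K ⧸ P) := by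
  rw [zdim_eq, idealOf_locus_of_isPrime]

theorem zdim_mono {S T : Set (AffinePoint σ K)} (h : S ⊆ T) : zdim S ≤ zdim T :=
  ringKrullDim_le_of_surjective (Ideal.Quotient.factor (idealOf_anti h))
    (Ideal.Quotient.factor_surjective _)

/-- The map of affine spaces with prescribed polynomial coordinates. -/
noncomputable def polyMap (φ : σ → MvPolynomial τ K) (x : AffinePoint τ K) : AffinePoint σ K :=
  fun i => evalAt x (φ i)

theorem evalAt_polyMap (φ : σ → MvPolynomial τ K) (x : AffinePoint τ K) (f : MvPolynomial σ K) :
    evalAt (polyMap φ x) f = evalAt x (aeval φ f) := by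
  suffices h : evalAt (polyMap φ x) = (evalAt x).comp (aeval φ) from DFunLike.congr_fun h f
  ext i
  rw [evalAt_X, AlgHom.comp_apply, aeval_X]
  rfl

theorem continuous_polyMap (φ : σ → MvPolynomial τ K) : Continuous (polyMap φ) := by
  refine continuous_iff_isClosed.2 fun S hS => ?_
  obtain ⟨I, rfl⟩ := (isClosed_iff_locus _).1 hS
  refine (isClosed_iff_locus _).2 ⟨I.map (aeval φ), ?_⟩
  rw [Ideal.map, locus_span]
  ext x
  simp [mem_locus, evalAt_polyMap]

/-- If `g ≠ 0` vanishes off `O` and `f` vanishes on `O`, then `f * g` vanishes everywhere, hence is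
zero over an infinite field. -/
theorem idealOf_eq_bot_of_isOpen [Infinite K] {O : Set (AffinePoint τ K)} (hO : IsOpen O)
    (hne : O.Nonempty) : idealOf O = ⊥ := by
  obtain ⟨I, hI⟩ := (isClosed_iff_locus Oᶜ).1 hO.isClosed_compl
  obtain ⟨x, hx⟩ := hne
  have hx' : x ∉ locus I := fun h => (hI ▸ h : x ∈ Oᶜ) hx
  obtain ⟨g, hg, hgx⟩ : ∃ g ∈ I, evalAt x g ≠ 0 := by
    by_contra! h
    exact hx' h
  refine (Submodule.eq_bot_iff _).2 fun f hf => ?_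
  have hfg : f * g = 0 := by
    refine MvPolynomial.funext fun y => ?_
    change evalAt (y : AffinePoint τ K) (f * g) = evalAt (y : AffinePoint τ K) 0
    rw [map_mul, map_zero, mul_eq_zero]
    by_cases hy : (y : AffinePoint τ K) ∈ O
    · exact Or.inl (hf y hy)
    · exact Or.inr ((hI ▸ hy : (y : AffinePoint τ K) ∈ locus I) g hg)
  rcases mul_eq_zero.1 hfg with h | h
  · exact h
  · simp [h] at hgx

/-- The closure of a set parametrized by a nonempty open subset of an affine space of dimension
`d` is irreducible of dimension at most `d`. -/
theorem isIrreducible_closure_image_polyMap [Infinite K] [Finite σ] [Finite τ]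
    (φ : σ → MvPolynomial τ K) {O : Set (AffinePoint τ K)} (hO : IsOpen O) (hne : O.Nonempty) :
    IsIrreducible (closure (polyMap φ '' O)) ∧
      zdim (closure (polyMap φ '' O)) ≤ (Nat.card τ : WithBot ℕ∞) := by
  have hker : idealOf (polyMap φ '' O) = RingHom.ker (aeval (R := K) φ) := by
    ext f
    rw [RingHom.mem_ker, ← Ideal.mem_bot, ← idealOf_eq_bot_of_isOpen hO hne,
      mem_idealOf, mem_idealOf, Set.forall_mem_image]
    exact forall₂_congr fun x _ => by rw [evalAt_polyMap]
  have := RingHom.ker_isPrime (aeval (R := K) φ)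
  constructor
  · rwa [isIrreducible_iff_isPrime, idealOf_closure, hker]
  -- The coordinate ring of the image embeds into the polynomial ring of the source, which bounds
  -- its transcendence degree.
  · rw [zdim_eq, idealOf_closure, hker, ringKrullDim_eq_trdeg K]
    have h : Cardinal.toENat _ ≤ Cardinal.toENat _ := Cardinal.toENat.monotone'
      (lift_trdeg_le_of_injective _ (Ideal.kerLiftAlg_injective (aeval (R := K) φ)))
    rw [MvPolynomial.trdeg_of_isDomain, ← Nat.cast_card] at h
    simp only [Cardinal.toENat_lift, Cardinal.lift_natCast, Cardinal.toENat_nat] at h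
    exact_mod_cast h

end Zariski

/-! ### Components and the number of equations -/

theorem natCast_add_le_natCast_add_iff {a b : WithBot ℕ∞} (n : ℕ) :
    (n : WithBot ℕ∞) + a ≤ n + b ↔ a ≤ b := by
  refine ⟨fun h => ?_, fun h => by gcongr⟩
  induction a with
  | bot => exact bot_le
  | coe a =>
    induction b with
    | bot => exact absurd h (by simp)
    | coe b =>
      have h' : (n : ℕ∞) + a ≤ n + b := by exact_mod_cast h
      exact_mod_cast (ENat.add_le_add_iff_left (ENat.natCast_ne_top n)).1 h'

theorem natCast_add_inj {a b : WithBot ℕ∞} (n : ℕ) :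
    (n : WithBot ℕ∞) + a = n + b ↔ a = b := by
  simp only [le_antisymm_iff, natCast_add_le_natCast_add_iff]

section Components

variable {σ τ K : Type*} [Field K] [IsAlgClosed K]

theorem card_le_card_add_zdim [Finite σ] (s : Finset (MvPolynomial σ K))
    {P : Ideal (MvPolynomial σ K)}
    (hP : P ∈ (Ideal.span (s : Set (MvPolynomial σ K))).minimalPrimes) :
    (Nat.card σ : WithBot ℕ∞) ≤ s.card + zdim (locus P) := by
  have := hP.1.1
  rw [zdim_locus, ← height_add_ringKrullDim_eq K σ P]
  gcongr
  exact_mod_cast Ideal.height_le_card_of_mem_minimalPrimes_span_finset hP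

/-- If a variety cut out by `c` equations has a nonempty open subset that is parametrized by an
affine space of codimension `c`, then the closure of this subset is a component of the least
dimension. -/
theorem isLeast_zdim_of_parametrization [Finite σ] [Finite τ] (s : Finset (MvPolynomial σ K))
    (hs : s.card + Nat.card τ ≤ Nat.card σ) {V O : Set (AffinePoint σ K)}
    (hV : V = locus (Ideal.span (s : Set (MvPolynomial σ K)))) (hO : IsOpen O)
    (hne : (V ∩ O).Nonempty) (φ : σ → MvPolynomial τ K) (hφ : ∀ x, polyMap φ x ∈ V)
    (hVO : V ∩ O ⊆ Set.range (polyMap φ)) :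
    IsIrreducible (closure (V ∩ O)) ∧
      zdim (closure (V ∩ O)) = (Nat.card τ : WithBot ℕ∞) ∧
      IsLeast (zdim '' components V) (Nat.card τ : WithBot ℕ∞) := by
  have hU : V ∩ O = polyMap φ '' (polyMap φ ⁻¹' O) := by
    ext p
    constructor
    · intro hp
      obtain ⟨x, rfl⟩ := hVO hp
      exact ⟨x, hp.2, rfl⟩
    · rintro ⟨x, hx, rfl⟩
      exact ⟨hφ x, hx⟩
  have hO' : IsOpen (polyMap φ ⁻¹' O) := hO.preimage (continuous_polyMap φ)
  obtain ⟨hirr, hdim⟩ := isIrreducible_closure_image_polyMap φ hO'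
    (by rw [hU] at hne; exact hne.of_image)
  rw [← hU] at hirr hdim
  have hmem : closure (V ∩ O) ∈ components V := by
    refine ⟨⟨hirr, closure_minimal Set.inter_subset_left (hV ▸ isClosed_locus _)⟩, ?_⟩
    rintro W ⟨hW, hWV⟩ hle
    -- A nonempty open part of an irreducible set is dense in it, so `W` lies in the closure of `W ∩
    -- O`.
    have hWO : (W ∩ O).Nonempty := by
      obtain ⟨p, hp⟩ := hne
      exact ⟨p, hle (subset_closure hp), hp.2⟩
    refine (subset_closure_inter_of_isPreirreducible_of_isOpen hW.2 hO hWO).trans ?_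
    exact closure_mono (Set.inter_subset_inter_left _ hWV)
  have hge : ∀ Z ∈ components V, (Nat.card τ : WithBot ℕ∞) ≤ zdim Z := by
    intro Z hZ
    rw [hV, mem_components_iff] at hZ
    obtain ⟨P, hP, rfl⟩ := hZ
    have h1 := card_le_card_add_zdim s hP
    have h2 : ((s.card : ℕ) : WithBot ℕ∞) + (Nat.card τ : WithBot ℕ∞) ≤ s.card + zdim (locus P) :=
      le_trans (by exact_mod_cast hs) h1
    exact (natCast_add_le_natCast_add_iff s.card).1 h2
  have heq := le_antisymm hdim (hge _ hmem)
  refine ⟨hirr, heq, ⟨_, hmem, heq⟩, ?_⟩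
  rintro _ ⟨Z, hZ, rfl⟩
  exact hge Z hZ

/-- For a variety cut out by `c` equations with a component of codimension at least `c`, being an
ideal-theoretic complete intersection means being equidimensional. -/
theorem isCompleteIntersection_iff [Finite σ] (s : Finset (MvPolynomial σ K)) (m : ℕ)
    (hs : s.card + m ≤ Nat.card σ)
    (hm : (m : WithBot ℕ∞) ∈
      zdim '' components (locus (Ideal.span (s : Set (MvPolynomial σ K))))) :
    IsCompleteIntersection (Ideal.span (s : Set (MvPolynomial σ K))) ↔
      ∀ Z ∈ components (locus (Ideal.span (s : Set (MvPolynomial σ K)))),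
        ∀ Z' ∈ components (locus (Ideal.span (s : Set (MvPolynomial σ K)))), zdim Z = zdim Z' := by
  set I := Ideal.span (s : Set (MvPolynomial σ K)) with hI
  constructor
  · rintro ⟨t, htI, ht⟩
    have key : ∀ Z ∈ components (locus I), (t.card : WithBot ℕ∞) + zdim Z = Nat.card σ := by
      intro Z hZ
      rw [mem_components_iff] at hZ
      obtain ⟨P, hP, rfl⟩ := hZ
      have := hP.1.1
      -- Krull bounds the height of a minimal prime above by the number of generators; the height of
      -- the ideal bounds it below.
      have hh : (t.card : ℕ∞) = P.height := by
        apply le_antisymm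
        · exact ht.trans_le (Ideal.height_mono hP.1.2)
        · rw [← htI] at hP
          exact Ideal.height_le_card_of_mem_minimalPrimes_span_finset hP
      rw [zdim_locus, ← height_add_ringKrullDim_eq K σ P, ← hh]
      rfl
    intro Z hZ Z' hZ'
    exact (natCast_add_inj t.card).1 ((key Z hZ).trans (key Z' hZ').symm)
  · intro h
    obtain ⟨Z₀, hZ₀, hm⟩ := hm
    refine ⟨s, rfl, le_antisymm ?_ ?_⟩
    · rw [Ideal.height_eq_inf_minimalPrimes]
      refine le_iInf₂ fun P hP => ?_
      have := hP.1.1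
      have h1 := height_add_ringKrullDim_eq K σ P
      rw [← zdim_locus, ← h Z₀ hZ₀ _ ((mem_components_iff _ _).2 ⟨P, hP, rfl⟩), hm] at h1
      have h2 : ((s.card : ℕ∞) : WithBot ℕ∞) + m ≤ P.height + m := by
        rw [h1]
        exact_mod_cast hs
      rw [add_comm, add_comm (P.height : WithBot ℕ∞), natCast_add_le_natCast_add_iff] at h2
      exact_mod_cast h2
    · obtain ⟨P, hP, -⟩ := (mem_components_iff _ _).1 hZ₀
      exact (Ideal.height_mono hP.1.2).trans
        (Ideal.height_le_card_of_mem_minimalPrimes_span_finset hP)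

theorem zdim_locus_le [Finite σ] (I : Ideal (MvPolynomial σ K)) {d : WithBot ℕ∞}
    (h : ∀ Z ∈ components (locus I), zdim Z ≤ d) : zdim (locus I) ≤ d := by
  rw [zdim_eq, idealOf_locus]
  refine ringKrullDim_quotient_le_of_minimalPrimes _ fun P hP => ?_
  rw [Ideal.radical_minimalPrimes] at hP
  have := hP.1.1
  rw [← zdim_locus]
  exact h _ ((mem_components_iff _ _).2 ⟨P, hP, rfl⟩)

/-- For a variety cut out by `c` equations with a component of codimension at least `c`, being a
set-theoretic complete intersection means being equidimensional. -/
theorem isSetTheoreticCompleteIntersection_iff [Fintype σ] (s : Finset (MvPolynomial σ K)) (m : ℕ)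
    (hs : s.card + m ≤ Nat.card σ)
    (hm : (m : WithBot ℕ∞) ∈
      zdim '' components (locus (Ideal.span (s : Set (MvPolynomial σ K))))) :
    IsSetTheoreticCompleteIntersection (locus (Ideal.span (s : Set (MvPolynomial σ K)))) ↔
      ∀ Z ∈ components (locus (Ideal.span (s : Set (MvPolynomial σ K)))),
        ∀ Z' ∈ components (locus (Ideal.span (s : Set (MvPolynomial σ K)))), zdim Z = zdim Z' := by
  set I := Ideal.span (s : Set (MvPolynomial σ K)) with hI
  constructor
  · rintro ⟨t, htI, ht⟩
    -- Krull for the equations `t` says that no component has smaller dimension than the whole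
    -- variety.
    have key : ∀ Z ∈ components (locus I), zdim Z = zdim (locus I) := by
      intro Z hZ
      refine le_antisymm (zdim_mono hZ.1.2) ?_
      change locus I = locus (Ideal.span (t : Set (MvPolynomial σ K))) at htI
      rw [htI, mem_components_iff] at hZ
      obtain ⟨P, hP, rfl⟩ := hZ
      rw [← natCast_add_le_natCast_add_iff t.card, add_comm, ht, ← Nat.card_eq_fintype_card]
      exact card_le_card_add_zdim t hP
    intro Z hZ Z' hZ'
    rw [key Z hZ, key Z' hZ']
  · intro h
    obtain ⟨Z₀, hZ₀, hm⟩ := hm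
    have hdim : zdim (locus I) = m := by
      refine le_antisymm (zdim_locus_le I fun Z hZ => ?_) (hm ▸ zdim_mono hZ₀.1.2)
      rw [h Z hZ Z₀ hZ₀, hm]
    refine ⟨s, rfl, ?_⟩
    rw [hdim, ← Nat.card_eq_fintype_card]
    apply le_antisymm
    · rw [add_comm]
      exact_mod_cast hs
    · obtain ⟨P, hP, rfl⟩ := (mem_components_iff _ _).1 hZ₀
      rw [← hm, add_comm]
      exact card_le_card_add_zdim s hP

end Components

end CommTri

/-! ### Cyclic vectors and centralizers of regular matrices -/

namespace CommTri

open Matrix Polynomial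

section Cyclic

/-- The matrix whose columns are `v, M v, M ^ 2 v, …`. -/
def krylov {n : ℕ} {R : Type*} [CommRing R] (M : Matrix (Fin n) (Fin n) R) (v : Fin n → R) :
    Matrix (Fin n) (Fin n) R :=
  Matrix.of fun i j => (M ^ (j : ℕ) *ᵥ v) i

theorem krylov_mulVec {n : ℕ} {R : Type*} [CommRing R] (M : Matrix (Fin n) (Fin n) R)
    (v c : Fin n → R) : krylov M v *ᵥ c = (∑ j : Fin n, c j • M ^ (j : ℕ)) *ᵥ v := by
  ext i
  simp only [Matrix.sum_mulVec, Matrix.smul_mulVec, Finset.sum_apply, Pi.smul_apply, smul_eq_mul]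
  rw [Matrix.mulVec, dotProduct]
  exact Finset.sum_congr rfl fun j _ => mul_comm (krylov M v i j) (c j)

theorem mul_krylov {n : ℕ} {R : Type*} [CommRing R] {M N : Matrix (Fin n) (Fin n) R}
    (h : Commute N M) (v : Fin n → R) : N * krylov M v = krylov M (N *ᵥ v) := by
  ext i j
  change (N *ᵥ (M ^ (j : ℕ) *ᵥ v)) i = (M ^ (j : ℕ) *ᵥ (N *ᵥ v)) i
  rw [Matrix.mulVec_mulVec, (h.pow_right j).eq, ← Matrix.mulVec_mulVec]

theorem map_krylov {n : ℕ} {R S : Type*} [CommRing R] [CommRing S] (f : R →+* S)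
    (M : Matrix (Fin n) (Fin n) R) (v : Fin n → R) :
    (krylov M v).map f = krylov (M.map f) (f ∘ v) := by
  ext i j
  rw [krylov, krylov, Matrix.map_apply, Matrix.of_apply, Matrix.of_apply, RingHom.map_mulVec,
    ← RingHom.mapMatrix_apply, ← RingHom.mapMatrix_apply, map_pow]

variable {n : ℕ} {K : Type*} [Field K]

theorem aeval_eq_sum_fin {A : Type*} [Semiring A] [Algebra K A] (M : A) {p : K[X]}
    (hp : p.degree < n) : aeval M p = ∑ j : Fin n, p.coeff j • M ^ (j : ℕ) := by
  rw [Fin.sum_univ_eq_sum_range (fun j => p.coeff j • M ^ j)]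
  by_cases h0 : p = 0
  · simp [h0]
  · exact aeval_eq_sum_range' ((natDegree_lt_iff_degree_lt h0).2 hp) M

theorem natDegree_minpoly_le (M : Matrix (Fin n) (Fin n) K) : (minpoly K M).natDegree ≤ n := by
  have := natDegree_le_of_dvd (Matrix.minpoly_dvd_charpoly M) M.charpoly_monic.ne_zero
  simpa [Matrix.charpoly_natDegree_eq_dim] using this

theorem isRegularMatrix_of_forall (M : Matrix (Fin n) (Fin n) K)
    (h : ∀ p : K[X], p.degree < n → aeval M p = 0 → p = 0) : IsRegularMatrix M := by
  refine (natDegree_minpoly_le M).antisymm (not_lt.1 fun hlt => ?_)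
  refine minpoly.ne_zero (Matrix.isIntegral M) (h _ ?_ (minpoly.aeval K M))
  exact (natDegree_lt_iff_degree_lt (minpoly.ne_zero (Matrix.isIntegral M))).1 hlt

theorem isRegularMatrix_of_det_krylov_ne_zero {M : Matrix (Fin n) (Fin n) K} {v : Fin n → K}
    (h : (krylov M v).det ≠ 0) : IsRegularMatrix M := by
  refine isRegularMatrix_of_forall M fun p hp hpM => ?_
  have h0 : (fun j : Fin n => p.coeff j) = 0 := by
    refine Matrix.eq_zero_of_mulVec_eq_zero h ?_
    rw [krylov_mulVec, ← aeval_eq_sum_fin M hp, hpM, Matrix.zero_mulVec]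
  ext i
  by_cases hi : i < n
  · exact congrFun h0 ⟨i, hi⟩
  · exact coeff_eq_zero_of_degree_lt (hp.trans_le (by exact_mod_cast not_lt.1 hi))

/-- A regular matrix over an algebraically closed field has a cyclic vector. -/
theorem exists_det_krylov_ne_zero [IsAlgClosed K] {M : Matrix (Fin n) (Fin n) K}
    (hM : IsRegularMatrix M) : ∃ v, (krylov M v).det ≠ 0 := by
  classical
  have hint : IsIntegral K M := Matrix.isIntegral M
  set p := minpoly K M with hp
  have hp0 : p ≠ 0 := minpoly.ne_zero hint
  -- A vector killed by no maximal proper divisor of `p`, evaluated at `M`, is cyclic. The kernels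
  -- to avoid are proper by minimality of `p`, and finitely many proper subspaces do not cover a
  -- space over an infinite field.
  let W : K → Submodule K (Fin n → K) := fun a =>
    LinearMap.ker (Matrix.mulVecLin (aeval M (p /ₘ (X - C a))))
  have hW : ∀ a ∈ p.roots.toFinset, W a ≠ ⊤ := by
    intro a ha hWa
    rw [LinearMap.ker_eq_top] at hWa
    have h0 : aeval M (p /ₘ (X - C a)) = 0 := by
      refine Matrix.ext_of_mulVec_single fun i => ?_
      have := congr($hWa (Pi.single i 1))
      simpa only [Matrix.mulVecLin_apply, LinearMap.zero_apply, Matrix.zero_mulVec] using this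
    have hroot : p.IsRoot a := (mem_roots hp0).1 (Multiset.mem_toFinset.1 ha)
    have hmul := mul_divByMonic_eq_iff_isRoot.2 hroot
    have hne : p /ₘ (X - C a) ≠ 0 := by
      rintro h
      rw [h, mul_zero] at hmul
      exact hp0 hmul.symm
    have hle := natDegree_le_of_dvd (minpoly.dvd K M h0) hne
    have := congrArg natDegree hmul
    rw [natDegree_mul (X_sub_C_ne_zero a) hne, natDegree_X_sub_C] at this
    rw [← hp] at hle
    omega
  have hcov := Subspace.biUnion_ne_univ_of_top_notMem (s := p.roots.toFinset.image W) (by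
    rw [Finset.mem_image]
    rintro ⟨a, ha, h⟩
    exact hW a ha h)
  obtain ⟨v, hv⟩ := (Set.ne_univ_iff_exists_notMem _).1 hcov
  refine ⟨v, fun hdet => hv ?_⟩
  obtain ⟨c, hc0, hc⟩ := Matrix.exists_mulVec_eq_zero_iff.2 hdet
  set f : K[X] := ∑ j : Fin n, monomial j (c j) with hf
  have hcoeff : ∀ j : Fin n, f.coeff j = c j := by
    intro j
    simp [hf, coeff_monomial, Fin.val_inj]
  have hf0 : f ≠ 0 := by
    intro h
    refine hc0 (funext fun j => ?_)
    rw [← hcoeff, h]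
    rfl
  have hfdeg : f.degree < n :=
    (degree_sum_le _ _).trans_lt ((Finset.sup_lt_iff (WithBot.bot_lt_coe n)).2 fun j _ =>
      (degree_monomial_le _ _).trans_lt (Nat.cast_lt.2 j.2))
  have hfv : aeval M f *ᵥ v = 0 := by
    rw [aeval_eq_sum_fin M hfdeg, ← hc, krylov_mulVec]
    simp only [hcoeff]
  -- By Bézout the gcd `g` also kills `v`. Since `f` has degree below `n`, the cofactor `h` is not
  -- constant and has a root `a`; then `g` divides `p / (X - a)`, which puts `v` into `W a`.
  obtain ⟨h, hgh⟩ := EuclideanDomain.gcd_dvd_right f p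
  set g := EuclideanDomain.gcd f p with hg
  have hgv : aeval M g *ᵥ v = 0 := by
    rw [hg, EuclideanDomain.gcd_eq_gcd_ab f p, map_add, mul_comm f, map_mul, map_mul,
      minpoly.aeval, zero_mul, add_zero, ← Matrix.mulVec_mulVec, hfv, Matrix.mulVec_zero]
  have hgdeg : g.natDegree < n :=
    (natDegree_le_of_dvd (EuclideanDomain.gcd_dvd_left f p) hf0).trans_lt
      ((natDegree_lt_iff_degree_lt hf0).2 hfdeg)
  have hdeg : p.natDegree = g.natDegree + h.natDegree := by
    rw [hgh, natDegree_mul (left_ne_zero_of_mul (hgh ▸ hp0)) (right_ne_zero_of_mul (hgh ▸ hp0))]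
  have hpn : p.natDegree = n := hM
  obtain ⟨a, ha⟩ := IsAlgClosed.exists_root h (fun hd => by
    have := natDegree_eq_of_degree_eq_some (n := 0) hd
    omega)
  obtain ⟨q, hq⟩ := dvd_iff_isRoot.2 ha
  have hpa : p = (X - C a) * (q * g) := by rw [hgh, hq]; ring
  rw [Set.mem_iUnion₂]
  refine ⟨W a, Finset.mem_image_of_mem _ ?_, ?_⟩
  · rw [Multiset.mem_toFinset, mem_roots hp0, ← dvd_iff_isRoot]
    exact ⟨_, hpa⟩
  · change aeval M (p /ₘ (X - C a)) *ᵥ v = 0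
    rw [hpa, mul_divByMonic_cancel_left _ (monic_X_sub_C a), map_mul, ← Matrix.mulVec_mulVec, hgv,
      Matrix.mulVec_zero]

/-- A matrix commuting with a regular matrix is a polynomial in it. -/
theorem exists_eq_sum_of_commute [IsAlgClosed K] {M N : Matrix (Fin n) (Fin n) K}
    (hM : IsRegularMatrix M) (h : Commute N M) :
    ∃ c : Fin n → K, N = ∑ j : Fin n, c j • M ^ (j : ℕ) := by
  obtain ⟨v, hv⟩ := exists_det_krylov_ne_zero hM
  have hunit : IsUnit (krylov M v) := (Matrix.isUnit_iff_isUnit_det _).2 hv.isUnit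
  obtain ⟨c, hc⟩ := (Matrix.mulVec_surjective_iff_isUnit.2 hunit) (N *ᵥ v)
  -- Both sides commute with `M` and agree on the cyclic vector, hence on the whole Krylov basis.
  refine ⟨c, hunit.mul_right_cancel ?_⟩
  have hcomm : Commute (∑ j : Fin n, c j • M ^ (j : ℕ)) M :=
    Commute.sum_left _ _ _ fun j _ => ((Commute.refl M).pow_left j).smul_left _
  rw [mul_krylov h, mul_krylov hcomm, ← krylov_mulVec, hc]

/-- The points where a matrix of polynomial functions is regular form an open set. -/
theorem isOpen_isRegularMatrix [IsAlgClosed K] {σ : Type*}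
    (G : Matrix (Fin n) (Fin n) (MvPolynomial σ K)) :
    IsOpen {p : AffinePoint σ K | IsRegularMatrix (G.map (evalAt p))} := by
  -- For a fixed `v`, being cyclic for the matrix is the nonvanishing of one polynomial in the
  -- coordinates.
  have heq : {p : AffinePoint σ K | IsRegularMatrix (G.map (evalAt p))} = ⋃ v : Fin n → K,
      (locus (Ideal.span {(krylov G (fun i => MvPolynomial.C (v i))).det}))ᶜ := by
    ext p
    have key : ∀ v : Fin n → K, evalAt p (krylov G (fun i => MvPolynomial.C (v i))).det =
        (krylov (G.map (evalAt p)) v).det := by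
      intro v
      have h1 := map_krylov (evalAt p : MvPolynomial σ K →+* K) G (fun i => MvPolynomial.C (v i))
      have h2 := RingHom.map_det (evalAt p : MvPolynomial σ K →+* K)
        (krylov G (fun i => MvPolynomial.C (v i)))
      rw [RingHom.mapMatrix_apply, h1] at h2
      refine h2.trans ?_
      congr 2
      ext i
      exact (evalAt p).commutes (v i)
    simp only [Set.mem_ofPred_eq, Set.mem_iUnion, Set.mem_compl_iff, locus_span,
      Set.mem_singleton_iff, forall_eq, key]
    exact ⟨exists_det_krylov_ne_zero, fun ⟨v, hv⟩ => isRegularMatrix_of_det_krylov_ne_zero hv⟩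
  rw [heq]
  exact isOpen_iUnion fun v => (isClosed_locus _).isOpen_compl

end Cyclic

end CommTri

/-! ### Upper triangular matrices and their commutators -/

namespace CommTri

open Matrix

section Upper

variable {n : ℕ} {R : Type*} [CommRing R]

theorem upper_blockTriangular (c : TriIdx n → R) : (upper c).BlockTriangular id :=
  (existsUnique_upper_eq_iff _).1 ⟨c, rfl, fun d hd => by
    funext p
    have := congrFun (congrFun hd p.1.1) p.1.2
    simpa [upper, p.2] using this⟩

theorem upper_apply (c : TriIdx n → R) (p : TriIdx n) : upper c p.1.1 p.1.2 = c p := by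
  simp [upper, p.2]

theorem upper_entries {M : Matrix (Fin n) (Fin n) R} (hM : M.BlockTriangular id) :
    upper (fun p : TriIdx n => M p.1.1 p.1.2) = M := by
  ext i j
  by_cases h : i ≤ j
  · simp [upper, h]
  · simp [upper, h, hM (not_le.1 h)]

theorem blockTriangular_pow {M : Matrix (Fin n) (Fin n) R} (hM : M.BlockTriangular id) (k : ℕ) :
    (M ^ k).BlockTriangular id := by
  induction k with
  | zero => rw [pow_zero]; exact blockTriangular_one
  | succ k ih => rw [pow_succ]; exact ih.mul hM

theorem blockTriangular_sum_smul_pow {M : Matrix (Fin n) (Fin n) R} (hM : M.BlockTriangular id)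
    {m : ℕ} (e : ℕ) (c : Fin m → R) :
    (∑ j : Fin m, c j • M ^ (e + j : ℕ)).BlockTriangular id := by
  intro i j hij
  rw [Matrix.sum_apply]
  refine Finset.sum_eq_zero fun k _ => ?_
  rw [Matrix.smul_apply, blockTriangular_pow hM _ hij, smul_zero]

theorem IsStrictlyUpper.mul {M N : Matrix (Fin n) (Fin n) R} (hM : IsStrictlyUpper M)
    (hN : N.BlockTriangular id) : IsStrictlyUpper (M * N) := by
  intro i j hij
  rw [Matrix.mul_apply]
  refine Finset.sum_eq_zero fun k _ => ?_
  by_cases h : k ≤ i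
  · rw [hM i k h, zero_mul]
  · rw [hN (show j < k from hij.trans_lt (not_le.1 h)), mul_zero]

theorem IsStrictlyUpper.blockTriangular {M : Matrix (Fin n) (Fin n) R} (hM : IsStrictlyUpper M) :
    M.BlockTriangular id := fun i j h => hM i j (le_of_lt h)

theorem IsStrictlyUpper.pow_succ {M : Matrix (Fin n) (Fin n) R} (hM : IsStrictlyUpper M) (k : ℕ) :
    IsStrictlyUpper (M ^ (1 + k)) := by
  rw [pow_add, pow_one]
  exact hM.mul (blockTriangular_pow hM.blockTriangular k)

/-- The diagonal of a commutator of upper triangular matrices vanishes. -/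
theorem commutator_apply_self {M N : Matrix (Fin n) (Fin n) R} (hM : M.BlockTriangular id)
    (hN : N.BlockTriangular id) (i : Fin n) : (M * N - N * M) i i = 0 := by
  have key : ∀ {M N : Matrix (Fin n) (Fin n) R}, M.BlockTriangular id → N.BlockTriangular id →
      (M * N) i i = M i i * N i i := by
    intro M N hM hN
    rw [Matrix.mul_apply]
    refine Finset.sum_eq_single i (fun k _ hk => ?_) (by simp)
    rcases hk.lt_or_gt with h | h
    · rw [hM h, zero_mul]
    · rw [hN h, mul_zero]
  rw [Matrix.sub_apply, key hM hN, key hN hM, mul_comm, sub_self]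

theorem commutator_eq_zero_iff {M N : Matrix (Fin n) (Fin n) R} (hM : M.BlockTriangular id)
    (hN : N.BlockTriangular id) :
    M * N - N * M = 0 ↔ ∀ i j, i < j → (M * N - N * M) i j = 0 := by
  refine ⟨fun h i j _ => by rw [h]; rfl, fun h => Matrix.ext fun i j => ?_⟩
  rcases lt_trichotomy i j with hij | rfl | hij
  · exact h i j hij
  · exact commutator_apply_self hM hN i
  · exact ((hM.mul hN).sub (hN.mul hM)) hij

/-- A product of two strictly upper triangular matrices vanishes on the first superdiagonal as well.
Dropping these `n - 1` equations is what makes the count for `NT n K` sharp. -/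
theorem IsStrictlyUpper.commutator_eq_zero_iff {M N : Matrix (Fin n) (Fin n) R}
    (hM : IsStrictlyUpper M) (hN : IsStrictlyUpper N) :
    M * N - N * M = 0 ↔ ∀ i j : Fin n, (i : ℕ) + 1 < j → (M * N - N * M) i j = 0 := by
  rw [CommTri.commutator_eq_zero_iff hM.blockTriangular hN.blockTriangular]
  refine ⟨fun h i j hij => h i j (by rw [Fin.lt_def]; omega), fun h i j hij => ?_⟩
  by_cases hij' : (i : ℕ) + 1 < j
  · exact h i j hij'
  · have key : ∀ {M N : Matrix (Fin n) (Fin n) R}, IsStrictlyUpper M → IsStrictlyUpper N →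
        (M * N) i j = 0 := by
      intro M N hM hN
      rw [Matrix.mul_apply]
      refine Finset.sum_eq_zero fun k _ => ?_
      by_cases hk : k ≤ i
      · rw [hM i k hk, zero_mul]
      · rw [hN k j (by rw [Fin.le_def] at hk ⊢; omega), mul_zero]
    rw [Matrix.sub_apply, key hM hN, key hN hM, sub_self]

end Upper

section Regular

variable {n : ℕ} {K : Type*} [Field K]

/-- The nilpotent Jordan block. -/
def jordanBlock (n : ℕ) (K : Type*) [Field K] : Matrix (Fin n) (Fin n) K :=
  Matrix.of fun i j => if (i : ℕ) + 1 = j then 1 else 0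

theorem jordanBlock_isStrictlyUpper : IsStrictlyUpper (jordanBlock n K) := by
  intro i j h
  rw [Fin.le_def] at h
  exact if_neg (by omega)

theorem jordanBlock_pow_apply (k : ℕ) (i j : Fin n) :
    (jordanBlock n K ^ k) i j = if (i : ℕ) + k = j then 1 else 0 := by
  induction k generalizing j with
  | zero => simp [Matrix.one_apply, Fin.ext_iff]
  | succ k ih =>
    rw [pow_succ, Matrix.mul_apply]
    simp only [ih]
    simp only [jordanBlock, Matrix.of_apply, mul_ite, mul_one, mul_zero]
    by_cases h : (i : ℕ) + (k + 1) = j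
    · rw [if_pos h, Finset.sum_eq_single ⟨i + k, by omega⟩]
      · simp
        omega
      · intro b _ hb
        rw [if_neg fun h' : (i : ℕ) + k = b => hb (Fin.ext h'.symm)]
        simp
      · simp
    · rw [if_neg h]
      refine Finset.sum_eq_zero fun b _ => ?_
      split_ifs <;> first | rfl | omega

/-- The top row of the `k`-th power has its only `1` in column `k`, so the powers below `n` are
linearly independent. -/
theorem jordanBlock_isRegularMatrix : IsRegularMatrix (jordanBlock n K) := by
  refine isRegularMatrix_of_forall _ fun p hp h0 => ?_
  ext i
  by_cases hi : i < n
  · have h1 := congrFun (congrFun h0 ⟨0, by omega⟩) ⟨i, hi⟩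
    rw [aeval_eq_sum_fin _ hp, Matrix.sum_apply, Finset.sum_eq_single ⟨i, hi⟩] at h1
    · simpa [jordanBlock_pow_apply] using h1
    · intro b _ hb
      rw [Matrix.smul_apply, jordanBlock_pow_apply, if_neg, smul_zero]
      intro h
      exact hb (Fin.ext (by simpa using h))
    · simp
  · exact Polynomial.coeff_eq_zero_of_degree_lt (hp.trans_le (Nat.cast_le.2 (not_lt.1 hi)))

/-- The constant term of a strictly upper triangular polynomial in a strictly upper triangular
matrix vanishes. -/
theorem exists_eq_sum_of_commute_of_isStrictlyUpper [IsAlgClosed K] (hn : 0 < n)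
    {M N : Matrix (Fin n) (Fin n) K} (hM : IsRegularMatrix M) (h : Commute N M)
    (hMs : IsStrictlyUpper M) (hNs : IsStrictlyUpper N) :
    ∃ c : Fin (n - 1) → K, N = ∑ j : Fin (n - 1), c j • M ^ (1 + j : ℕ) := by
  obtain ⟨m, rfl⟩ : ∃ m, n = m + 1 := ⟨n - 1, by omega⟩
  obtain ⟨c, hc⟩ := exists_eq_sum_of_commute hM h
  have hsum : N = c 0 • 1 + ∑ j : Fin m, c j.succ • M ^ (1 + j : ℕ) := by
    rw [hc, Fin.sum_univ_succ]
    simp [add_comm]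
  -- Positive powers of `M` have zero diagonal, so the corner entry of `N` is `c 0`.
  have h0 : c 0 = 0 := by
    have := congrFun (congrFun hsum 0) 0
    rw [hNs 0 0 le_rfl, Matrix.add_apply, Matrix.sum_apply, Finset.sum_eq_zero] at this
    · simpa using this.symm
    · intro j _
      rw [Matrix.smul_apply, hMs.pow_succ j 0 0 le_rfl, smul_zero]
  rw [h0, zero_smul, zero_add] at hsum
  exact ⟨fun j => c j.succ, hsum⟩

end Regular

/-! ### Parametrization of the regular pairs -/

section Param

variable {n : ℕ} {K : Type*} [Field K]

/-- The pair with given upper triangular members. -/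
def pairOf (M N : Matrix (Fin n) (Fin n) K) : TriPair n K :=
  Sum.elim (fun p => M p.1.1 p.1.2) fun p => N p.1.1 p.1.2

theorem fst_pairOf {M : Matrix (Fin n) (Fin n) K} (hM : M.BlockTriangular id)
    (N : Matrix (Fin n) (Fin n) K) : (pairOf M N).fst = M := upper_entries hM

theorem snd_pairOf (M : Matrix (Fin n) (Fin n) K) {N : Matrix (Fin n) (Fin n) K}
    (hN : N.BlockTriangular id) : (pairOf M N).snd = N := upper_entries hN

theorem pairOf_fst_snd (p : TriPair n K) : pairOf p.fst p.snd = p := by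
  funext i
  rcases i with i | i
  · exact upper_apply (fun a => p (Sum.inl a)) i
  · exact upper_apply (fun a => p (Sum.inr a)) i

/-- The matrix with prescribed entries at the positions satisfying `r`. -/
def fillIn {R : Type*} [Zero R] (r : Fin n → Fin n → Prop) [DecidableRel r]
    (c : {p : Fin n × Fin n // r p.1 p.2} → R) : Matrix (Fin n) (Fin n) R :=
  Matrix.of fun i j => if h : r i j then c ⟨(i, j), h⟩ else 0

/-- The coordinates of the pair `(X, ∑ j, c j • X ^ (e + j))`, where `X` is the generic matrix
supported on `r`. -/
noncomputable def polyPair (r : Fin n → Fin n → Prop) [DecidableRel r] (e m : ℕ) :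
    PairIdx n → MvPolynomial ({p : Fin n × Fin n // r p.1 p.2} ⊕ Fin m) K :=
  let G : Matrix (Fin n) (Fin n) (MvPolynomial ({p : Fin n × Fin n // r p.1 p.2} ⊕ Fin m) K) :=
    fillIn r fun p => MvPolynomial.X (Sum.inl p)
  let c : Fin m → MvPolynomial ({p : Fin n × Fin n // r p.1 p.2} ⊕ Fin m) K :=
    fun j => MvPolynomial.X (Sum.inr j)
  Sum.elim (fun p => G p.1.1 p.1.2) fun p => (∑ j : Fin m, c j • G ^ (e + j : ℕ)) p.1.1 p.1.2

theorem polyMap_polyPair (r : Fin n → Fin n → Prop) [DecidableRel r] (e m : ℕ)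
    (x : AffinePoint ({p : Fin n × Fin n // r p.1 p.2} ⊕ Fin m) K) :
    polyMap (polyPair r e m) x = pairOf (fillIn r fun p => x (Sum.inl p))
      (∑ j : Fin m, x (Sum.inr j) • (fillIn r fun p => x (Sum.inl p)) ^ (e + j : ℕ)) := by
  set G : Matrix (Fin n) (Fin n) (MvPolynomial ({p : Fin n × Fin n // r p.1 p.2} ⊕ Fin m) K) :=
    fillIn r fun p => MvPolynomial.X (Sum.inl p) with hG
  set c : Fin m → MvPolynomial ({p : Fin n × Fin n // r p.1 p.2} ⊕ Fin m) K :=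
    fun j => MvPolynomial.X (Sum.inr j) with hc
  have hGx : G.map (evalAt x) = fillIn r fun p => x (Sum.inl p) := by
    ext i j
    by_cases h : r i j
    · simp [hG, fillIn, h]
    · simp [hG, fillIn, h]
  rw [← hGx]
  funext i
  rcases i with i | i
  · rfl
  · change evalAt x ((∑ j : Fin m, c j • G ^ (e + j : ℕ)) i.1.1 i.1.2) =
      (∑ j : Fin m, x (Sum.inr j) • (G.map (evalAt x)) ^ (e + j : ℕ)) i.1.1 i.1.2
    rw [Matrix.sum_apply, Matrix.sum_apply, map_sum]
    refine Finset.sum_congr rfl fun j _ => ?_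
    rw [Matrix.smul_apply, Matrix.smul_apply, smul_eq_mul, smul_eq_mul, map_mul, evalAt_X,
      ← AlgHom.mapMatrix_apply, ← map_pow, AlgHom.mapMatrix_apply, Matrix.map_apply]

theorem commute_sum_smul_pow (M : Matrix (Fin n) (Fin n) K) {m : ℕ} (e : ℕ) (c : Fin m → K) :
    Commute M (∑ j : Fin m, c j • M ^ (e + j : ℕ)) :=
  Commute.sum_right _ _ _ fun j _ => ((Commute.refl M).pow_right (e + j)).smul_right (c j)

theorem pairOf_mem_CT {M N : Matrix (Fin n) (Fin n) K} (hM : M.BlockTriangular id)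
    (hN : N.BlockTriangular id) (h : Commute M N) : pairOf M N ∈ CT n K := by
  change (pairOf M N).fst * (pairOf M N).snd - (pairOf M N).snd * (pairOf M N).fst = 0
  rw [fst_pairOf hM, snd_pairOf _ hN, h.eq, sub_self]

/-- The set of pairs of regular matrices. -/
def regularPairs (n : ℕ) (K : Type*) [Field K] : Set (TriPair n K) :=
  {p | IsRegularMatrix p.fst ∧ IsRegularMatrix p.snd}

theorem isOpen_regularPairs [IsAlgClosed K] : IsOpen (regularPairs n K) := by
  have key : ∀ f : TriIdx n → PairIdx n,
      IsOpen {p : TriPair n K | IsRegularMatrix (upper fun a => p (f a))} := by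
    intro f
    convert isOpen_isRegularMatrix (K := K)
      (upper fun a => (MvPolynomial.X (f a) : MvPolynomial (PairIdx n) K)) using 4 with p
    ext i j
    by_cases h : i ≤ j
    · simp [upper, h]
    · simp [upper, h]
  exact (key Sum.inl).inter (key Sum.inr)

/-- One witness shows that the regular locus is nonempty in both varieties. -/
theorem pairOf_jordanBlock_mem :
    pairOf (jordanBlock n K) (jordanBlock n K) ∈ NT n K ∩ regularPairs n K := by
  have hJ := jordanBlock_isStrictlyUpper (n := n) (K := K)
  have hb := hJ.blockTriangular
  refine ⟨⟨pairOf_mem_CT hb hb (Commute.refl _), ?_⟩, ?_⟩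
  · change IsStrictlyUpper (pairOf _ _).fst ∧ IsStrictlyUpper (pairOf _ _).snd
    rw [fst_pairOf hb, snd_pairOf _ hb]
    exact ⟨hJ, hJ⟩
  · change IsRegularMatrix (pairOf _ _).fst ∧ IsRegularMatrix (pairOf _ _).snd
    rw [fst_pairOf hb, snd_pairOf _ hb]
    exact ⟨jordanBlock_isRegularMatrix, jordanBlock_isRegularMatrix⟩

end Param

end CommTri

/-! ### Counting parameters and equations -/

namespace CommTri

open Matrix

section Count

/-- Column `j` contributes the rows `i < j + 1 - c`; truncated subtraction correctly gives none when
`c > j`. -/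
theorem card_filter_add_le (n c : ℕ) :
    (Finset.univ.filter fun p : Fin n × Fin n => (p.1 : ℕ) + c ≤ p.2).card =
      ∑ j ∈ Finset.range n, (j + 1 - c) := by
  rw [Finset.card_filter, ← Finset.univ_product_univ, Finset.sum_product_right,
    ← Fin.sum_univ_eq_sum_range fun j => j + 1 - c]
  refine Finset.sum_congr rfl fun j _ => ?_
  dsimp only
  rw [Fin.sum_univ_eq_sum_range (fun i => if i + c ≤ (j : ℕ) then 1 else 0) n,
    ← Finset.card_filter]
  have : (Finset.range n).filter (fun i => i + c ≤ (j : ℕ)) = Finset.range (j + 1 - c) := by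
    ext i
    simp only [Finset.mem_filter, Finset.mem_range]
    omega
  rw [this, Finset.card_range]

theorem card_le_pairs (n : ℕ) :
    Fintype.card {p : Fin n × Fin n // p.1 ≤ p.2} = ∑ j ∈ Finset.range n, j + n := by
  rw [Fintype.card_subtype]
  refine (card_filter_add_le n 0).trans ?_
  simp [Finset.sum_add_distrib]

theorem card_lt_pairs (n : ℕ) :
    Fintype.card {p : Fin n × Fin n // p.1 < p.2} = ∑ j ∈ Finset.range n, j := by
  rw [Fintype.card_subtype]
  exact card_filter_add_le n 1

theorem sum_range_sub_one_add (n : ℕ) :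
    ∑ j ∈ Finset.range n, (j - 1) + (n - 1) = ∑ j ∈ Finset.range n, j := by
  induction n with
  | zero => rfl
  | succ n ih =>
    rw [Finset.sum_range_succ, Finset.sum_range_succ, ← ih]
    omega

theorem mul_add_three_div_two (n : ℕ) :
    n * (n + 3) / 2 = ∑ j ∈ Finset.range n, j + n + n := by
  have h := Finset.sum_range_id_mul_two n
  rcases n with _ | n
  · rfl
  · rw [Nat.add_sub_cancel] at h
    refine Nat.div_eq_of_eq_mul_left two_pos ?_
    linarith

theorem mul_add_one_div_two_sub_one {n : ℕ} (hn : 0 < n) :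
    n * (n + 1) / 2 - 1 = ∑ j ∈ Finset.range n, j + (n - 1) := by
  have h := Finset.sum_range_id_mul_two n
  have h2 : n * (n + 1) / 2 = ∑ j ∈ Finset.range n, j + n := by
    rcases n with _ | n
    · rfl
    · rw [Nat.add_sub_cancel] at h
      refine Nat.div_eq_of_eq_mul_left two_pos ?_
      linarith
  omega

end Count

variable (n : ℕ) (K : Type*) [Field K]

theorem evalAt_genericCommutator (p : TriPair n K) (i j : Fin n) :
    evalAt p (genericCommutator n K i j) = (p.fst * p.snd - p.snd * p.fst) i j := by
  simp only [genericCommutator, Matrix.sub_apply, Matrix.mul_apply, map_sub, map_sum, map_mul,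
    upper, TriPair.fst, TriPair.snd, Matrix.of_apply, apply_dite (evalAt p), evalAt_X, map_zero]

open scoped Classical in
/-- The entries above the diagonal of the generic commutator. -/
noncomputable def commEquations : Finset (MvPolynomial (PairIdx n) K) :=
  (Finset.univ.filter fun p : Fin n × Fin n => (p.1 : ℕ) + 1 ≤ p.2).image
    fun p => genericCommutator n K p.1 p.2

open scoped Classical in
theorem card_commEquations_le : (commEquations n K).card ≤ ∑ j ∈ Finset.range n, j :=
  Finset.card_image_le.trans (card_filter_add_le n 1).le

open scoped Classical in
-- The entries on and below the diagonal are identically zero for generic upper triangular matrices.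
theorem span_commEquations : Ideal.span (commEquations n K : Set _) = commIdeal n K := by
  have hX := upper_blockTriangular
    fun a : TriIdx n => (MvPolynomial.X (Sum.inl a) : MvPolynomial (PairIdx n) K)
  have hY := upper_blockTriangular
    fun a : TriIdx n => (MvPolynomial.X (Sum.inr a) : MvPolynomial (PairIdx n) K)
  apply le_antisymm
  · refine Ideal.span_mono fun f hf => ?_
    obtain ⟨p, -, rfl⟩ := Finset.mem_image.1 (Finset.mem_coe.1 hf)
    exact ⟨_, _, rfl⟩
  · rw [commIdeal, Ideal.span_le]
    rintro _ ⟨i, j, rfl⟩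
    rcases lt_trichotomy i j with h | rfl | h
    · exact Ideal.subset_span (Finset.mem_coe.2 (Finset.mem_image.2
        ⟨(i, j), Finset.mem_filter.2 ⟨Finset.mem_univ _, h⟩, rfl⟩))
    · rw [show genericCommutator n K i i = 0 from commutator_apply_self hX hY i]
      exact Ideal.zero_mem _
    · rw [show genericCommutator n K i j = 0 from ((hX.mul hY).sub (hY.mul hX)) h]
      exact Ideal.zero_mem _

theorem CT_eq_locus : CT n K = locus (Ideal.span (commEquations n K : Set _)) := by
  rw [span_commEquations]
  exact (zeroLocus_commIdeal n K).symm

open scoped Classical in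
/-- Equations of `NT_n`: the diagonal entries of both matrices, and the entries of the commutator
above the first superdiagonal. -/
noncomputable def nilEquations : Finset (MvPolynomial (PairIdx n) K) :=
  ((Finset.univ.filter fun p : Fin n × Fin n => (p.1 : ℕ) + 2 ≤ p.2).image
    fun p => genericCommutator n K p.1 p.2) ∪
  (Finset.univ : Finset (Fin n ⊕ Fin n)).image
    (fun i => MvPolynomial.X (i.map (fun i => ⟨(i, i), le_rfl⟩) fun i => ⟨(i, i), le_rfl⟩))

open scoped Classical in
theorem card_nilEquations_le :
    (nilEquations n K).card ≤ ∑ j ∈ Finset.range n, (j - 1) + 2 * n := by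
  refine (Finset.card_union_le _ _).trans (add_le_add ?_ ?_)
  · exact Finset.card_image_le.trans (card_filter_add_le n 2).le
  · refine Finset.card_image_le.trans ?_
    simp [two_mul]

variable {n K}

theorem isStrictlyUpper_upper_iff (c : TriIdx n → K) :
    IsStrictlyUpper (upper c) ↔ ∀ i : Fin n, c ⟨(i, i), le_rfl⟩ = 0 := by
  constructor
  · intro h i
    rw [← upper_apply c]
    exact h i i le_rfl
  · intro h i j hij
    rcases hij.eq_or_lt with rfl | hij
    · exact (upper_apply c ⟨(j, j), le_rfl⟩).trans (h j)
    · exact upper_blockTriangular c hij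

variable (n K)

theorem NT_eq_locus : NT n K = locus (Ideal.span (nilEquations n K : Set _)) := by
  ext p
  rw [locus_span]
  simp only [nilEquations, Finset.coe_union, Finset.coe_image, Finset.coe_univ, Set.image_univ,
    Finset.coe_filter, Finset.mem_univ, true_and, Set.mem_union, or_imp, forall_and,
    Set.forall_mem_image, Set.forall_mem_range, Set.mem_ofPred_eq, Sum.forall, Sum.map_inl,
    Sum.map_inr, evalAt_X, evalAt_genericCommutator, Prod.forall]
  change (_ = 0 ∧ IsStrictlyUpper p.fst ∧ IsStrictlyUpper p.snd) ↔ _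
  rw [and_comm, and_comm (b := _ ∧ _)]
  have : (IsStrictlyUpper p.fst ∧ IsStrictlyUpper p.snd) ↔ _ :=
    and_congr (isStrictlyUpper_upper_iff fun a => p (Sum.inl a))
      (isStrictlyUpper_upper_iff fun a => p (Sum.inr a))
  rw [← this]
  exact and_congr_right fun h => h.1.commutator_eq_zero_iff h.2

/-! ### The minimal components -/

variable [IsAlgClosed K]

/-- At most `n(n-1)/2` equations in `n(n+1)` variables, against `n(n+1)/2 + n` parameters: the
totals match. -/
theorem isLeast_CT :
    IsIrreducible (CT0 n K) ∧ zdim (CT0 n K) = ((n * (n + 3) / 2 : ℕ) : WithBot ℕ∞) ∧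
      IsLeast (zdim '' components (CT n K)) ((n * (n + 3) / 2 : ℕ) : WithBot ℕ∞) := by
  have hcard : Nat.card ({p : Fin n × Fin n // p.1 ≤ p.2} ⊕ Fin n) = n * (n + 3) / 2 := by
    rw [Nat.card_eq_fintype_card, Fintype.card_sum, card_le_pairs, Fintype.card_fin,
      mul_add_three_div_two]
  rw [← hcard]
  refine isLeast_zdim_of_parametrization (commEquations n K) ?_ (CT_eq_locus n K)
    (isOpen_regularPairs (n := n) (K := K)) ?_ (polyPair (· ≤ ·) 0 n) ?_ ?_
  · rw [hcard, mul_add_three_div_two, Nat.card_eq_fintype_card, Fintype.card_sum, card_le_pairs]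
    have := card_commEquations_le n K
    omega
  · exact ⟨_, pairOf_jordanBlock_mem.1.1, pairOf_jordanBlock_mem.2⟩
  · intro x
    rw [polyMap_polyPair]
    have hb : (fillIn (· ≤ ·) fun p => x (Sum.inl p)).BlockTriangular id :=
      upper_blockTriangular fun p => x (Sum.inl p)
    exact pairOf_mem_CT hb (blockTriangular_sum_smul_pow hb 0 _) (commute_sum_smul_pow _ 0 _)
  · rintro (p : TriPair n K) ⟨hp, hreg, -⟩
    obtain ⟨c, hc⟩ := exists_eq_sum_of_commute hreg (sub_eq_zero.1 hp).symm
    refine ⟨Sum.elim (fun a => p (Sum.inl a)) c, ?_⟩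
    refine (polyMap_polyPair _ _ _ _).trans (Eq.trans ?_ (pairOf_fst_snd p))
    rw [hc]
    simp only [zero_add]
    rfl

/-- At most `(n-1)(n-2)/2 + 2n` equations in `n(n+1)` variables, against `n(n-1)/2 + (n-1)`
parameters. Exponents start at `1` because the constant term vanishes. -/
theorem isLeast_NT (hn : 0 < n) :
    IsIrreducible (NT0 n K) ∧ zdim (NT0 n K) = ((n * (n + 1) / 2 - 1 : ℕ) : WithBot ℕ∞) ∧
      IsLeast (zdim '' components (NT n K)) ((n * (n + 1) / 2 - 1 : ℕ) : WithBot ℕ∞) := by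
  have hcard : Nat.card ({p : Fin n × Fin n // p.1 < p.2} ⊕ Fin (n - 1)) =
      n * (n + 1) / 2 - 1 := by
    rw [Nat.card_eq_fintype_card, Fintype.card_sum, card_lt_pairs, Fintype.card_fin,
      mul_add_one_div_two_sub_one hn]
  rw [← hcard]
  refine isLeast_zdim_of_parametrization (nilEquations n K) ?_ (NT_eq_locus n K)
    (isOpen_regularPairs (n := n) (K := K)) ⟨_, pairOf_jordanBlock_mem⟩
    (polyPair (· < ·) 1 (n - 1)) ?_ ?_
  · rw [hcard, mul_add_one_div_two_sub_one hn, Nat.card_eq_fintype_card, Fintype.card_sum,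
      card_le_pairs]
    have := card_nilEquations_le n K
    have := sum_range_sub_one_add n
    omega
  · intro x
    rw [polyMap_polyPair]
    have hs : IsStrictlyUpper (fillIn (· < ·) fun p => x (Sum.inl p)) :=
      fun i j hij => dif_neg (not_lt.2 hij)
    have hb := hs.blockTriangular
    have hN := blockTriangular_sum_smul_pow hb 1 fun j : Fin (n - 1) => x (Sum.inr j)
    refine ⟨pairOf_mem_CT hb hN (commute_sum_smul_pow _ 1 _), ?_⟩
    change IsStrictlyUpper (pairOf _ _).fst ∧ IsStrictlyUpper (pairOf _ _).snd
    rw [fst_pairOf hb, snd_pairOf _ hN]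
    refine ⟨hs, fun i j hij => ?_⟩
    rw [Matrix.sum_apply]
    refine Finset.sum_eq_zero fun k _ => ?_
    rw [Matrix.smul_apply, hs.pow_succ k i j hij, smul_zero]
  · rintro (p : TriPair n K) ⟨⟨hp, hs, hs'⟩, hreg, -⟩
    obtain ⟨c, hc⟩ := exists_eq_sum_of_commute_of_isStrictlyUpper hn hreg
      (sub_eq_zero.1 hp).symm hs hs'
    refine ⟨Sum.elim (fun a => p.fst a.1.1 a.1.2) c, ?_⟩
    have hfill : (fillIn (· < ·) fun a : {a : Fin n × Fin n // a.1 < a.2} => p.fst a.1.1 a.1.2) =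
        p.fst := by
      ext i j
      by_cases h : i < j
      · simp [fillIn, h]
      · simp [fillIn, h, hs i j (not_lt.1 h)]
    refine (polyMap_polyPair _ _ _ _).trans (Eq.trans ?_ (pairOf_fst_snd p))
    rw [hc]
    simp only [Sum.elim_inl, Sum.elim_inr, hfill]

end CommTri

theorem mainTheorem4 (K : Type*) [Field K] [IsAlgClosed K] (n : ℕ) (hn : 0 < n) :
    (IsIrreducible (CommTri.CT0 n K) ∧
      CommTri.zdim (CommTri.CT0 n K) = ((n * (n + 3) / 2 : ℕ) : WithBot ℕ∞) ∧
      IsLeast (CommTri.zdim '' CommTri.components (CommTri.CT n K))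
        ((n * (n + 3) / 2 : ℕ) : WithBot ℕ∞)) ∧
    (IsIrreducible (CommTri.NT0 n K) ∧
      CommTri.zdim (CommTri.NT0 n K) = ((n * (n + 1) / 2 - 1 : ℕ) : WithBot ℕ∞) ∧
      IsLeast (CommTri.zdim '' CommTri.components (CommTri.NT n K))
        ((n * (n + 1) / 2 - 1 : ℕ) : WithBot ℕ∞)) ∧
    (CommTri.IsCompleteIntersection (CommTri.commIdeal n K) ↔
      ∀ Z ∈ CommTri.components (CommTri.CT n K), ∀ Z' ∈ CommTri.components (CommTri.CT n K),
        CommTri.zdim Z = CommTri.zdim Z') ∧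
    (CommTri.IsSetTheoreticCompleteIntersection (CommTri.CT n K) ↔
      ∀ Z ∈ CommTri.components (CommTri.CT n K), ∀ Z' ∈ CommTri.components (CommTri.CT n K),
        CommTri.zdim Z = CommTri.zdim Z') := by
  have hCT := CommTri.isLeast_CT n K
  have hm := hCT.2.2.1
  have hs : (CommTri.commEquations n K).card + n * (n + 3) / 2 ≤ Nat.card (CommTri.PairIdx n) := by
    rw [CommTri.mul_add_three_div_two, Nat.card_eq_fintype_card, Fintype.card_sum,
      CommTri.card_le_pairs]
    have := CommTri.card_commEquations_le n K
    omega
  refine ⟨hCT, CommTri.isLeast_NT n K hn, ?_, ?_⟩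
  · rw [CommTri.CT_eq_locus] at hm ⊢
    rw [← CommTri.span_commEquations]
    exact CommTri.isCompleteIntersection_iff _ _ hs hm
  · rw [CommTri.CT_eq_locus] at hm ⊢
    exact CommTri.isSetTheoreticCompleteIntersection_iff _ _ hs hm
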